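/- Let $G$ be a finite simple graph with vertex set $V$ and let $\mathcal A$ be its set of arcs (ordered pairs $(u,v)$ with $uv$ an edge); $t(a)$ is the terminus and $a^{-1}$ the reverse of an arc $a$. Let $N\in\mathbb C^{V\times\mathcal A}$, $N_{ua}=\frac{1}{\sqrt{\deg u}}\delta_{u,t(a)}$, and $S\in\mathbb C^{\mathcal A\times\mathcal A}$, $S_{ab}=\delta_{a,b^{-1}}$. The Grover walk on $G$ has time evolution matrix $U=S(2N^*N-I)$, and the discriminant of $G$ is $P=NSN^*$. For $u\in V$ put $\Phi_u=N^*\mathbf e_u$. Perfect state transfer occurs from $u$ to another vertex $v\neq u$ at time $\tau$ if $U^\tau\Phi_u=\gamma\Phi_v$ for some $\gamma\in\mathbb C$ with $|\gamma|=1$; it occurs on $G$ at time $\tau$ if it occurs from $u$ to $v$ at time $\tau$ for some pair of distinct vertices $u,v$. Let $G$ be a distance-regular graph of diameter $d$, that is, $G$ is connected and for any vertices $u,v$ the number of vertices at distance $i$ from $u$ and distance $j$ from $v$ depends only on $i$, $j$ and $\operatorname{dist}(u,v)$. Then $P$ has exactly $d+1$ distinct eigenvalues, all of them real; write them as $\mu_0>\cdots>\mu_d$.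 Let $T_\tau$ denote the Chebyshev polynomial of the first kind of degree $\tau$. Then for every integer $\tau\ge 0$, perfect state transfer occurs on $G$ at time $\tau$ if and only if the following two conditions hold. (i) $G$ is antipodal with fibres of size $2$: any two distinct vertices at distance $d$ from a common vertex are at distance $d$ from each other, and for every vertex $u$ the fibre $\{u\}\cup\{v:\operatorname{dist}(u,v)=d\}$ has exactly two elements. (ii) $T_\tau(\mu_j)=(-1)^j$ for all $j\in\{0,\dots,d\}$. Moreover, if (i) and (ii) hold, then perfect state transfer at time $\tau$ is exactly between antipodal vertices: for all $u,v\in V$, it occurs from $u$ to $v$ at time $\tau$ if and only if $\operatorname{dist}(u,v)=d$. -/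

import Mathlib

namespace GroverWalk

open scoped Matrix

/-- A connected graph is distance-regular if the number of vertices at distance `i` from `u` and
at distance `j` from `v` depends only on `i`, `j` and the distance between `u` and `v`. -/
def IsDistanceRegular {V : Type*} (G : SimpleGraph V) : Prop :=
  G.Connected ∧
    ∀ i j : ℕ, ∀ u v u' v' : V, G.dist u v = G.dist u' v' →
      {w : V | G.dist u w = i ∧ G.dist v w = j}.ncard =
        {w : V | G.dist u' w = i ∧ G.dist v' w = j}.ncard

/-- The vertices at distance `d` (the diameter) from a given vertex are at distance `d` from each
other. -/
def IsAntipodal {V : Type*} (G : SimpleGraph V) : Prop :=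
  ∀ u v w : V, G.dist u v = G.diam → G.dist u w = G.diam → v ≠ w → G.dist v w = G.diam

/-- The fibre of `u`: the vertex `u` together with all vertices at distance `d` (the diameter)
from it. When `G` is antipodal these sets are the cliques whose disjoint union is the
distance-`d` graph. -/
def fibre {V : Type*} (G : SimpleGraph V) (u : V) : Set V :=
  {v : V | v = u ∨ G.dist u v = G.diam}

section Walk

variable {V : Type*} [Fintype V] [DecidableEq V] (G : SimpleGraph V) [DecidableRel G.Adj]

/-- The shift matrix, `S a b = δ_{a, b⁻¹}`; arcs `(u, v)` are darts with origin `u = fst` and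
terminus `v = snd`. -/
def shift : Matrix G.Dart G.Dart ℂ :=
  Matrix.of fun a b => if a = b.symm then 1 else 0

/-- The boundary matrix, `N u a = δ_{u, t(a)} / √(deg u)`. -/
noncomputable def boundary : Matrix V G.Dart ℂ :=
  Matrix.of fun u a => if u = a.snd then 1 / ((Real.sqrt (G.degree u) : ℝ) : ℂ) else 0

/-- The coin matrix `K = 2 N* N - I`. -/
noncomputable def coin : Matrix G.Dart G.Dart ℂ :=
  (2 : ℂ) • ((boundary G)ᴴ * boundary G) - 1

/-- The time evolution matrix `U = S K` of the Grover walk. -/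
noncomputable def evolution : Matrix G.Dart G.Dart ℂ :=
  shift G * coin G

/-- The discriminant `P = N S N*`. -/
noncomputable def discriminant : Matrix V V ℂ :=
  boundary G * shift G * (boundary G)ᴴ

/-- The vertex-type state `Φ_u = N* e_u`. -/
noncomputable def vertexState (u : V) : G.Dart → ℂ :=
  (boundary G)ᴴ *ᵥ Pi.single u 1

/-- Perfect state transfer from the vertex `u` to another vertex `v` at time `τ`. -/
def PSTFromTo (u v : V) (τ : ℕ) : Prop :=
  u ≠ v ∧ ∃ γ : ℂ, ‖γ‖ = 1 ∧ evolution G ^ τ *ᵥ vertexState G u = γ • vertexState G v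

/-- Perfect state transfer occurs on `G` at time `τ`. -/
def HasPST (τ : ℕ) : Prop :=
  ∃ u v : V, PSTFromTo G u v τ

/-- `μ 0 > μ 1 > ⋯ > μ d` are exactly the distinct eigenvalues of the discriminant of `G`. -/
def IsOrderedDiscriminantSpectrum {d : ℕ} (μ : Fin (d + 1) → ℝ) : Prop :=
  StrictAnti μ ∧
    ∀ z : ℂ, Module.End.HasEigenvalue (Matrix.toLin' (discriminant G)) z ↔ ∃ j, z = (μ j : ℂ)

end Walk

end GroverWalk

namespace GroverWalk

open scoped Matrix
open Polynomial
open scoped ComplexOrder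

/-! ### The walk compressed to vertex states -/

section Walk

variable {V : Type*} [DecidableEq V] (G : SimpleGraph V)

/-! Since `N N* = 1` (no isolated vertices), the powers of `U` compress to `N U^τ N* = T_τ(P)`. As
`U` is unitary, transfer from `u` to `v` with phase `γ` amounts to `T_τ(P) e_u = γ e_v`.

On a distance-regular graph, polynomials in `P` are exactly the real-combination matrices whose
entries depend only on distance. One column `γ e_v` of `T_τ(P)` therefore determines the whole
matrix: it is supported on one distance `j`, whose spheres are single points. This forces `j = d`
(`IsDistanceRegular.eq_diam_of_unique`), and row sums give `γ = 1`, so `T_τ(P)` is the distance-`d`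
matrix `A_d`, a fixed-point-free involution.

It remains to find the spectrum of `A_d = p(P)`. Its values on the `μ_j` are `±1`, with value `1` at
`μ_0 = 1`. The matrix `A_d` is trace-orthogonal to polynomials in `P` of degree below `d`, which
forces a sign change between consecutive eigenvalues (`eval_eq_neg_one_pow_of_aeval_eq`).
Conversely, two polynomials agreeing on the spectrum agree at `P`, so condition (ii) gives `T_τ(P) =
A_d`. -/

theorem shift_conjTranspose : (shift G)ᴴ = shift G := by
  ext a b
  simp only [shift, Matrix.conjTranspose_apply, Matrix.of_apply]
  have : b = a.symm ↔ a = b.symm :=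
    ⟨fun h => by rw [h, SimpleGraph.Dart.symm_symm], fun h => by rw [h, SimpleGraph.Dart.symm_symm]⟩
  simp [this, apply_ite]

variable [Fintype V] [DecidableRel G.Adj]

theorem shift_mul_apply {n : Type*} (M : Matrix G.Dart n ℂ) (a : G.Dart) (j : n) :
    (shift G * M) a j = M a.symm j := by
  have : ∀ b : G.Dart, a = b.symm ↔ b = a.symm := fun b =>
    ⟨fun h => by rw [h, SimpleGraph.Dart.symm_symm], fun h => by rw [h, SimpleGraph.Dart.symm_symm]⟩
  simp [Matrix.mul_apply, shift, this]

theorem shift_mul_shift : shift G * shift G = 1 := by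
  ext a b
  rw [shift_mul_apply]
  simp [shift, Matrix.one_apply, SimpleGraph.Dart.symm_involutive.injective.eq_iff]

theorem card_filter_dart_snd (u : V) :
    (Finset.univ.filter fun a : G.Dart => u = a.snd).card = G.degree u := by
  classical
  rw [← G.dart_fst_fiber_card_eq_degree u]
  refine Finset.card_bij (fun a _ => a.symm) ?_ ?_ ?_
  · intro a ha
    simpa [eq_comm] using ha
  · intro a _ b _ h
    exact SimpleGraph.Dart.symm_involutive.injective h
  · intro b hb
    refine ⟨b.symm, ?_, b.symm_symm⟩
    simpa [eq_comm] using hb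

/-- The rows of the boundary matrix are orthonormal if there is no isolated vertex. -/
theorem boundary_mul_conjTranspose (h : ∀ u, 0 < G.degree u) :
    boundary G * (boundary G)ᴴ = 1 := by
  ext u v
  simp only [Matrix.mul_apply, Matrix.conjTranspose_apply, boundary, Matrix.of_apply,
    Matrix.one_apply]
  split_ifs with huv
  · subst huv
    have hs : (((Real.sqrt (G.degree u) : ℝ) : ℂ)) * ((Real.sqrt (G.degree u) : ℝ) : ℂ)
        = (G.degree u : ℂ) := by
      rw [← Complex.ofReal_mul, Real.mul_self_sqrt (Nat.cast_nonneg _)]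
      simp
    have h0 : (G.degree u : ℂ) ≠ 0 := by exact_mod_cast (h u).ne'
    have : ∀ a : G.Dart, ((if u = a.snd then 1 / ((Real.sqrt (G.degree u) : ℝ) : ℂ) else 0) *
        star (if u = a.snd then 1 / ((Real.sqrt (G.degree u) : ℝ) : ℂ) else 0)) =
        if u = a.snd then 1 / (G.degree u : ℂ) else 0 := by
      intro a
      split_ifs
      · rw [← hs]
        simp
      · simp
    rw [Finset.sum_congr rfl fun a _ => this a, ← Finset.sum_filter, Finset.sum_const,
      card_filter_dart_snd, nsmul_eq_mul, mul_one_div_cancel h0]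
  · refine Finset.sum_eq_zero fun a _ => ?_
    by_cases h1 : u = a.snd
    · have h2 : v ≠ a.snd := fun h2 => huv (h1.trans h2.symm)
      simp [h2]
    · simp [h1]

/-- On a `k`-regular graph the discriminant is `A / k`. -/
theorem discriminant_eq_smul_adjMatrix {k : ℕ} (h : ∀ u, G.degree u = k) :
    discriminant G = ((1 / k : ℝ) : ℂ) • G.adjMatrix ℂ := by
  ext u v
  have hs : ((1 / k : ℝ) : ℂ) = 1 / ((Real.sqrt k : ℝ) : ℂ) * (1 / ((Real.sqrt k : ℝ) : ℂ)) := by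
    rw [one_div_mul_one_div, ← Complex.ofReal_mul, Real.mul_self_sqrt (Nat.cast_nonneg k)]
    simp
  rw [discriminant, Matrix.mul_assoc, Matrix.mul_apply]
  simp only [shift_mul_apply, boundary, Matrix.conjTranspose_apply, Matrix.of_apply,
    Matrix.smul_apply, SimpleGraph.adjMatrix_apply, h]
  by_cases huv : G.Adj u v
  · rw [Finset.sum_eq_single (⟨(v, u), huv.symm⟩ : G.Dart)]
    · simp [huv]
      simpa using hs.symm
    · intro a _ ha
      by_cases h1 : u = a.snd
      · by_cases h2 : v = a.fst
        · exact absurd (SimpleGraph.Dart.ext _ _ (Prod.ext h2.symm h1.symm)) ha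
        · simp [h2]
      · simp [h1]
    · simp
  · rw [Finset.sum_eq_zero]
    · simp [huv]
    · intro a _
      by_cases h1 : u = a.snd
      · by_cases h2 : v = a.fst
        · exact absurd (h1 ▸ h2 ▸ a.adj.symm) huv
        · simp [h2]
      · simp [h1]

variable {G}

theorem coin_conjTranspose : (coin G)ᴴ = coin G := by
  simp [coin, Matrix.conjTranspose_sub, Matrix.conjTranspose_smul]

theorem coin_mul_coin (h : boundary G * (boundary G)ᴴ = 1) : coin G * coin G = 1 := by
  have h2 : (boundary G)ᴴ * boundary G * ((boundary G)ᴴ * boundary G) =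
      (boundary G)ᴴ * boundary G := by
    rw [Matrix.mul_assoc, ← Matrix.mul_assoc (boundary G), h, Matrix.one_mul]
  simp only [coin, sub_mul, mul_sub, smul_mul_assoc, mul_smul_comm, h2, mul_one, one_mul]
  module

/-- The time evolution matrix is unitary. -/
theorem evolution_conjTranspose_mul (h : boundary G * (boundary G)ᴴ = 1) :
    (evolution G)ᴴ * evolution G = 1 := by
  rw [evolution, Matrix.conjTranspose_mul, coin_conjTranspose, shift_conjTranspose,
    Matrix.mul_assoc, ← Matrix.mul_assoc (shift G), shift_mul_shift, Matrix.one_mul,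
    coin_mul_coin h]

theorem evolution_pow_conjTranspose_mul (h : boundary G * (boundary G)ᴴ = 1) (τ : ℕ) :
    (evolution G ^ τ)ᴴ * evolution G ^ τ = 1 := by
  induction τ with
  | zero => simp
  | succ n ih =>
    rw [pow_succ, Matrix.conjTranspose_mul, Matrix.mul_assoc, ← Matrix.mul_assoc _ _ (evolution G),
      ih, Matrix.one_mul, evolution_conjTranspose_mul h]

theorem coin_mul_boundary (h : boundary G * (boundary G)ᴴ = 1) :
    coin G * (boundary G)ᴴ = (boundary G)ᴴ := by
  rw [coin, Matrix.sub_mul, Matrix.smul_mul, Matrix.mul_assoc, h, Matrix.mul_one, Matrix.one_mul]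
  module

/-- This is the Chebyshev recurrence at operator level. The coin fixes the range of `N*`, so `U N* =
S N*`; applying `U` again and using `S² = 1` yields the term `2 U N* P - N*`. -/
theorem evolution_mul_evolution_mul_boundary (h : boundary G * (boundary G)ᴴ = 1) :
    evolution G * (evolution G * (boundary G)ᴴ) =
      (2 : ℂ) • (evolution G * (boundary G)ᴴ * discriminant G) - (boundary G)ᴴ := by
  have h1 : evolution G * (boundary G)ᴴ = shift G * (boundary G)ᴴ := by
    rw [evolution, Matrix.mul_assoc, coin_mul_boundary h]
  have h2 : coin G * (shift G * (boundary G)ᴴ) =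
      (2 : ℂ) • ((boundary G)ᴴ * discriminant G) - shift G * (boundary G)ᴴ := by
    rw [coin, Matrix.sub_mul, Matrix.smul_mul, Matrix.one_mul, discriminant]
    simp only [Matrix.mul_assoc]
  rw [h1, evolution, Matrix.mul_assoc, h2, Matrix.mul_sub, Matrix.mul_smul, ← Matrix.mul_assoc _ _
    (discriminant G), ← Matrix.mul_assoc (shift G) (shift G), shift_mul_shift, Matrix.one_mul]

/-- Compressing powers of the time evolution matrix to vertex states gives Chebyshev polynomials
of the discriminant. -/
theorem boundary_mul_evolution_pow_mul (h : boundary G * (boundary G)ᴴ = 1) (τ : ℕ) :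
    boundary G * evolution G ^ τ * (boundary G)ᴴ =
      aeval (discriminant G) (Chebyshev.T ℝ (τ : ℤ)) := by
  induction τ using Nat.twoStepInduction with
  | zero => simp [h]
  | one =>
    simp [evolution, discriminant, Matrix.mul_assoc, coin_mul_boundary h]
  | more n ih0 ih1 =>
    have hT : Chebyshev.T ℝ ((n + 2 : ℕ) : ℤ) =
        Chebyshev.T ℝ ((n + 1 : ℕ) : ℤ) * (C 2 * X) - Chebyshev.T ℝ (n : ℤ) := by
      push_cast
      rw [Chebyshev.T_add_two]
      simp only [map_ofNat]
      ring
    rw [hT, map_sub, map_mul, ← ih0, ← ih1, pow_add, pow_two, pow_succ]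
    have := congrArg (fun M => boundary G * evolution G ^ n * M)
      (evolution_mul_evolution_mul_boundary h)
    simp only [Matrix.mul_sub, Matrix.mul_smul] at this
    simp only [Matrix.mul_assoc] at this ⊢
    rw [this]
    simp only [map_mul, aeval_C, aeval_X]
    congr 1
    have h2 : (algebraMap ℝ (Matrix V V ℂ)) 2 = 2 := map_ofNat _ 2
    rw [h2, two_mul (discriminant G), Matrix.mul_add, Matrix.mul_add, Matrix.mul_add,
      Matrix.mul_add, two_smul]

/-- State transfer between vertex states is read off from a Chebyshev polynomial of the
discriminant. -/
theorem evolution_pow_mulVec_vertexState_iff (h : boundary G * (boundary G)ᴴ = 1) (τ : ℕ)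
    (u v : V) {γ : ℂ} (hγ : ‖γ‖ = 1) :
    evolution G ^ τ *ᵥ vertexState G u = γ • vertexState G v ↔
      aeval (discriminant G) (Chebyshev.T ℝ (τ : ℤ)) *ᵥ Pi.single u 1 = γ • Pi.single v 1 := by
  have hN : ∀ w, boundary G *ᵥ vertexState G w = Pi.single w 1 := fun w => by
    rw [vertexState, Matrix.mulVec_mulVec, h, Matrix.one_mulVec]
  rw [← boundary_mul_evolution_pow_mul h, ← Matrix.mulVec_mulVec, ← vertexState,
    ← Matrix.mulVec_mulVec]
  constructor
  · intro hU
    rw [hU, Matrix.mulVec_smul, hN]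
  · intro hx
    -- Equality case of Cauchy–Schwarz: `x` and `Φ_v` are unit vectors with inner product `γ` of
    -- modulus one, so expanding `‖x - γ Φ_v‖²` gives zero.
    set x := evolution G ^ τ *ᵥ vertexState G u with hxdef
    have hΦ : ∀ (w : V) (y : G.Dart → ℂ),
        star (vertexState G w) ⬝ᵥ y = (boundary G *ᵥ y) w := fun w y => by
      rw [vertexState, Matrix.star_mulVec, ← Matrix.dotProduct_mulVec,
        Matrix.conjTranspose_conjTranspose]
      have : (star (Pi.single w 1 : V → ℂ)) = Pi.single w 1 := by
        rw [Pi.star_def]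
        ext i
        by_cases hi : i = w
        · subst hi; simp
        · simp [hi]
      rw [this, single_one_dotProduct]
    have hγ2 : star γ * γ = 1 := by
      have := Complex.conj_mul' γ
      rw [hγ] at this
      simpa using this
    have hxx : star x ⬝ᵥ x = 1 := by
      rw [hxdef, Matrix.star_mulVec, ← Matrix.dotProduct_mulVec, Matrix.mulVec_mulVec,
        evolution_pow_conjTranspose_mul h, Matrix.one_mulVec, hΦ, hN, Pi.single_eq_same]
    have hvx : star (vertexState G v) ⬝ᵥ x = γ := by
      rw [hΦ, hx]
      simp
    have hxv : star x ⬝ᵥ vertexState G v = star γ := by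
      rw [← hvx, Matrix.star_dotProduct]
    have hvv : star (vertexState G v) ⬝ᵥ vertexState G v = 1 := by
      rw [hΦ, hN, Pi.single_eq_same]
    rw [← sub_eq_zero, ← dotProduct_star_self_eq_zero]
    rw [star_sub, star_smul, sub_dotProduct, dotProduct_sub, dotProduct_sub, smul_dotProduct,
      smul_dotProduct, dotProduct_smul, dotProduct_smul, hxx, hvx, hxv, hvv]
    simp only [smul_eq_mul, mul_one]
    rw [hγ2, mul_comm γ, hγ2]
    ring

end Walk

/-! ### Geodesics and spheres consisting of one point -/

section Distance

variable {V : Type*} {G : SimpleGraph V}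

theorem exists_dist_eq_of_le (hc : G.Connected) {u v : V} {i : ℕ} (hi : i ≤ G.dist u v) :
    ∃ w, G.dist u w = i ∧ G.dist w v = G.dist u v - i := by
  obtain ⟨p, hp⟩ := hc.exists_walk_length_eq_dist u v
  refine ⟨p.getVert i, ?_⟩
  have h1 := G.dist_le (p.take i)
  have h2 := G.dist_le (p.drop i)
  have h3 := hc.dist_triangle (u := u) (v := p.getVert i) (w := v)
  rw [SimpleGraph.Walk.take_length] at h1
  rw [SimpleGraph.Walk.drop_length] at h2
  omega

theorem IsDistanceRegular.dist_le_diam [Finite V] (hG : IsDistanceRegular G) (x y : V) :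
    G.dist x y ≤ G.diam :=
  have := hG.1.nonempty
  SimpleGraph.dist_le_diam (SimpleGraph.connected_iff_ediam_ne_top.1 hG.1)

theorem IsDistanceRegular.ncard_sphere_eq (hG : IsDistanceRegular G) (i : ℕ) (u v : V) :
    {w : V | G.dist u w = i}.ncard = {w : V | G.dist v w = i}.ncard := by
  simpa using hG.2 i i u u v v (by simp)

/-- If every vertex has exactly one vertex at distance `j`, taking this vertex is self-adjoint with
respect to the distance. -/
theorem IsDistanceRegular.dist_partner_comm [Finite V] (hG : IsDistanceRegular G) {j : ℕ}
    (hj : ∀ u v w, G.dist u v = j → G.dist u w = j → v = w) {u u' x x' : V}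
    (hu : G.dist u u' = j) (hx : G.dist x x' = j) : G.dist u' x = G.dist u x' := by
  -- Swapping the pair `(u, x)` preserves the intersection number. The vertex `u'` is counted on one
  -- side, so the other side is nonempty, and its member can only be `x'`.
  have h := hG.2 j (G.dist u' x) u x x u G.dist_comm
  have h1 : {w : V | G.dist u w = j ∧ G.dist x w = G.dist u' x}.Nonempty :=
    ⟨u', hu, G.dist_comm⟩
  have h2 : {w : V | G.dist x w = j ∧ G.dist u w = G.dist u' x}.Nonempty := by
    rw [← Set.ncard_pos, ← h, Set.ncard_pos]
    exact h1
  obtain ⟨w, hw1, hw2⟩ := h2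
  rw [← hw2, hj x w x' hw1 hx]

/-- A distance `j ≥ 1` for which every sphere of radius `j` is a single point is the diameter. -/
theorem IsDistanceRegular.eq_diam_of_unique [Finite V] (hG : IsDistanceRegular G) {j : ℕ}
    (hj0 : 0 < j) (hex : ∀ u, ∃ v, G.dist u v = j)
    (hj : ∀ u v w, G.dist u v = j → G.dist u w = j → v = w) : j = G.diam := by
  have hc := hG.1
  have := hc.nonempty
  obtain ⟨u, y, huy⟩ := G.exists_dist_eq_diam
  obtain ⟨v, hv⟩ := hex u
  have hle : j ≤ G.diam := hv ▸ hG.dist_le_diam u v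
  by_contra hne
  -- If `j < d`, take `x` at distance `j + 1` from `u`; a geodesic to it passes through the partner
  -- `v` of `u`. For `z` next to `u` on a geodesic to `v`, the partner of `x` is `z`.
  -- Self-adjointness then equates `dist u x = j + 1` with `dist v z = j - 1`.
  have hlt : j + 1 ≤ G.dist u y := by omega
  obtain ⟨x, hx, -⟩ := exists_dist_eq_of_le hc hlt
  obtain ⟨v', hv', hvx⟩ := exists_dist_eq_of_le hc (u := u) (v := x) (i := j) (by omega)
  obtain rfl := hj u v v' hv hv'
  obtain ⟨z, hz, hzv⟩ := exists_dist_eq_of_le hc (u := u) (v := v) (i := 1) (by omega)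
  have h1 := hc.dist_triangle (u := z) (v := v) (w := x)
  have h2 := hc.dist_triangle (u := u) (v := z) (w := x)
  have hzx : G.dist z x = j := by omega
  have hvu : G.dist v u = j := by rw [G.dist_comm, hv]
  have h3 := hG.dist_partner_comm hj hvu (x := x) (x' := z) (by rw [G.dist_comm, hzx])
  rw [G.dist_comm (u := v)] at h3
  omega

end Distance

/-! ### Polynomials in the discriminant and distance matrices -/

section Discriminant

variable {V : Type*} [Fintype V] {G : SimpleGraph V} [DecidableRel G.Adj]

theorem IsDistanceRegular.degree_eq (hG : IsDistanceRegular G) (u v : V) :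
    G.degree u = G.degree v := by
  have hs : ∀ w, {x : V | G.dist w x = 1}.ncard = G.degree w := fun w => by
    rw [← SimpleGraph.card_neighborFinset_eq_degree, ← Set.ncard_coe_finset]
    congr 1
    ext x
    simp
  rw [← hs, ← hs, hG.ncard_sphere_eq]

theorem IsDistanceRegular.degree_pos [Nontrivial V] (hG : IsDistanceRegular G) (u : V) :
    0 < G.degree u :=
  hG.1.preconnected.degree_pos_of_nontrivial u

variable (G) in
/-- Matrices whose entries are real and depend only on the distance. -/
def HasDistanceEntries (M : Matrix V V ℂ) (f : ℕ → ℝ) : Prop :=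
  ∀ x y, M x y = (f (G.dist x y) : ℂ)

theorem IsDistanceRegular.exists_adjMatrix_mul (hG : IsDistanceRegular G) {M : Matrix V V ℂ}
    {f : ℕ → ℝ} (hM : HasDistanceEntries G M f) :
    ∃ g, HasDistanceEntries G (G.adjMatrix ℂ * M) g := by
  classical
  let s : V → V → ℝ := fun x y => ∑ w ∈ G.neighborFinset x, f (G.dist w y)
  have hs : ∀ x y x' y', G.dist x y = G.dist x' y' → s x y = s x' y' := by
    intro x y x' y' h
    -- Grouping the neighbours of `x` by their distance to `y` turns the entry into a sum weighted
    -- by intersection numbers.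
    have key : ∀ x y, s x y = ∑ j ∈ Finset.univ.image (fun p : V × V => G.dist p.1 p.2),
        ({w : V | G.dist x w = 1 ∧ G.dist y w = j}.ncard : ℝ) * f j := by
      intro x y
      simp only [s]
      rw [← Finset.sum_fiberwise_of_maps_to (t := Finset.univ.image
        (fun p : V × V => G.dist p.1 p.2)) (g := fun w => G.dist y w)
        (fun w _ => Finset.mem_image.2 ⟨(y, w), Finset.mem_univ _, rfl⟩)]
      refine Finset.sum_congr rfl fun j _ => ?_
      rw [Finset.sum_congr rfl (g := fun _ => f j), Finset.sum_const, nsmul_eq_mul]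
      · congr 2
        rw [← Set.ncard_coe_finset]
        congr 1
        ext w
        simp
      · intro w hw
        rw [G.dist_comm, (Finset.mem_filter.1 hw).2]
    rw [key, key]
    refine Finset.sum_congr rfl fun j _ => ?_
    rw [hG.2 1 j x y x' y' h]
  -- The value `0` at distances that do not occur is never read.
  refine ⟨fun i => if h : ∃ p : V × V, G.dist p.1 p.2 = i then s h.choose.1 h.choose.2 else 0,
    fun x y => ?_⟩
  have hex : ∃ p : V × V, G.dist p.1 p.2 = G.dist x y := ⟨(x, y), rfl⟩
  dsimp only
  rw [dif_pos hex, hs _ _ x y hex.choose_spec, SimpleGraph.adjMatrix_mul_apply]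
  simp only [s, Complex.ofReal_sum]
  exact Finset.sum_congr rfl fun w _ => hM w y

variable [DecidableEq V]

theorem discriminant_isHermitian (G : SimpleGraph V) [DecidableRel G.Adj] :
    (discriminant G).IsHermitian := by
  rw [Matrix.IsHermitian, discriminant, Matrix.conjTranspose_mul, Matrix.conjTranspose_mul,
    Matrix.conjTranspose_conjTranspose, shift_conjTranspose, Matrix.mul_assoc]

theorem IsDistanceRegular.exists_discriminant_eq (hG : IsDistanceRegular G) :
    ∃ k : ℕ, (∀ u, G.degree u = k) ∧ discriminant G = ((1 / k : ℝ) : ℂ) • G.adjMatrix ℂ := by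
  have := hG.1.nonempty
  obtain ⟨u⟩ := this
  exact ⟨G.degree u, fun v => hG.degree_eq v u,
    discriminant_eq_smul_adjMatrix G fun v => hG.degree_eq v u⟩

theorem IsDistanceRegular.exists_discriminant_pow (hG : IsDistanceRegular G) (n : ℕ) :
    ∃ f, HasDistanceEntries G (discriminant G ^ n) f := by
  obtain ⟨k, -, hP⟩ := hG.exists_discriminant_eq
  induction n with
  | zero =>
    refine ⟨fun i => if i = 0 then 1 else 0, fun x y => ?_⟩
    simp only [pow_zero, Matrix.one_apply, hG.1.dist_eq_zero_iff]
    split_ifs <;> simp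
  | succ n ih =>
    obtain ⟨f, hf⟩ := ih
    obtain ⟨g, hg⟩ := hG.exists_adjMatrix_mul hf
    refine ⟨fun i => 1 / k * g i, fun x y => ?_⟩
    rw [pow_succ', hP, Matrix.smul_mul, Matrix.smul_apply, ← hP, hg x y]
    simp

theorem IsDistanceRegular.discriminant_pow_apply_eq_zero (hG : IsDistanceRegular G) {n : ℕ}
    {x y : V} (h : n < G.dist x y) : (discriminant G ^ n) x y = 0 := by
  obtain ⟨k, -, hP⟩ := hG.exists_discriminant_eq
  rw [hP, _root_.smul_pow, Matrix.smul_apply, SimpleGraph.adjMatrix_pow_apply_eq_card_walk]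
  have : IsEmpty {p : G.Walk x y | p.length = n} :=
    ⟨fun p => absurd ((G.dist_le p.1).trans_eq p.2) (not_le.2 h)⟩
  simp [Fintype.card_eq_zero]

/-- A geodesic is a walk of the right length. Together with the vanishing of lower powers, this
makes the powers of `P` triangular with respect to distance. -/
theorem IsDistanceRegular.discriminant_pow_dist_apply_ne_zero (hG : IsDistanceRegular G)
    (x y : V) : (discriminant G ^ G.dist x y) x y ≠ 0 := by
  obtain ⟨k, hk, hP⟩ := hG.exists_discriminant_eq
  by_cases hxy : x = y
  · subst hxy; simp
  have hnt : Nontrivial V := ⟨x, y, hxy⟩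
  have hk0 : k ≠ 0 := by
    rw [← hk x]
    exact (hG.degree_pos x).ne'
  rw [hP, _root_.smul_pow, Matrix.smul_apply, SimpleGraph.adjMatrix_pow_apply_eq_card_walk]
  obtain ⟨p, hp⟩ := hG.1.exists_walk_length_eq_dist x y
  have : Nonempty {q : G.Walk x y | q.length = G.dist x y} := ⟨⟨p, hp⟩⟩
  have h1 := Fintype.card_pos (α := {q : G.Walk x y | q.length = G.dist x y})
  refine smul_ne_zero (pow_ne_zero _ ?_) (by exact_mod_cast h1.ne')
  simpa using hk0

theorem IsDistanceRegular.aeval_discriminant_apply_eq_zero (hG : IsDistanceRegular G) {p : ℝ[X]}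
    {x y : V} (h : p.natDegree < G.dist x y) : aeval (discriminant G) p x y = 0 := by
  rw [aeval_eq_sum_range, Matrix.sum_apply]
  refine Finset.sum_eq_zero fun i hi => ?_
  rw [Matrix.smul_apply, hG.discriminant_pow_apply_eq_zero, smul_zero]
  have := Finset.mem_range.1 hi
  omega

theorem IsDistanceRegular.exists_aeval_discriminant (hG : IsDistanceRegular G) (p : ℝ[X]) :
    ∃ f, HasDistanceEntries G (aeval (discriminant G) p) f := by
  choose f hf using hG.exists_discriminant_pow
  refine ⟨fun i => ∑ n ∈ Finset.range (p.natDegree + 1), p.coeff n * f n i, fun x y => ?_⟩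
  rw [aeval_eq_sum_range, Matrix.sum_apply, Complex.ofReal_sum]
  refine Finset.sum_congr rfl fun n _ => ?_
  rw [Matrix.smul_apply, hf n x y]
  simp

/-- A matrix with distance entries supported on distances less than `n` is a polynomial of degree
less than `n` in the discriminant. -/
theorem IsDistanceRegular.exists_polynomial (hG : IsDistanceRegular G) (n : ℕ)
    {M : Matrix V V ℂ} {f : ℕ → ℝ} (hM : HasDistanceEntries G M f)
    (hf : ∀ x y, n ≤ G.dist x y → f (G.dist x y) = 0) :
    ∃ p : ℝ[X], p.degree < n ∧ aeval (discriminant G) p = M := by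
  induction n generalizing M f with
  | zero =>
    refine ⟨0, by simp, ?_⟩
    ext x y
    rw [hM x y, hf x y (Nat.zero_le _)]
    simp
  | succ n ih =>
    obtain ⟨g, hg⟩ := hG.exists_discriminant_pow n
    -- Triangular elimination: this multiple of `P^n` cancels the entries at distance `n`. If `g n =
    -- 0`, that distance does not occur and the coefficient is harmless.
    have hM' : HasDistanceEntries G (M - (f n / g n) • discriminant G ^ n)
        (fun i => f i - f n / g n * g i) := fun x y => by
      rw [Matrix.sub_apply, Matrix.smul_apply, hM x y, hg x y]
      simp
    obtain ⟨p, hp, hpM⟩ := ih hM' (by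
      intro x y hxy
      rcases hxy.eq_or_lt with h | h
      · have h0 : g n ≠ 0 := by
          intro h0
          have := hG.discriminant_pow_dist_apply_ne_zero x y
          rw [← h, hg x y, ← h, h0] at this
          simp at this
        rw [← h]
        field_simp
        simp
      · have h0 : g (G.dist x y) = 0 := by
          have := hG.discriminant_pow_apply_eq_zero h
          rw [hg x y] at this
          exact_mod_cast this
        simp [hf x y h, h0])
    refine ⟨p + C (f n / g n) * X ^ n, ?_, ?_⟩
    · refine (degree_add_le _ _).trans_lt (max_lt (hp.trans ?_)
        ((degree_C_mul_X_pow_le _ _).trans_lt ?_)) <;> exact_mod_cast Nat.lt_succ_self n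
    · rw [map_add, hpM, map_mul, map_pow, aeval_C, aeval_X, ← Algebra.smul_def]
      simp

end Discriminant

/-! ### Functional calculus for Hermitian matrices -/

section Spectral

variable {n : Type*} [Fintype n] [DecidableEq n] {A : Matrix n n ℂ}

theorem aeval_eq_conj_diagonal (hA : A.IsHermitian) (p : ℝ[X]) :
    aeval A p = Unitary.conjStarAlgAut ℂ _ hA.eigenvectorUnitary
      (Matrix.diagonal fun i => ((p.eval (hA.eigenvalues i) : ℝ) : ℂ)) := by
  induction p using Polynomial.induction_on' with
  | add p q hp hq =>
    rw [map_add, hp, hq, ← map_add, Matrix.diagonal_add]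
    simp
  | monomial k a =>
    have h : (Matrix.diagonal fun i => (((monomial k a).eval (hA.eigenvalues i) : ℝ) : ℂ)) =
        (a : ℂ) • Matrix.diagonal (RCLike.ofReal ∘ hA.eigenvalues) ^ k := by
      rw [Matrix.diagonal_pow, ← Matrix.diagonal_smul]
      congr 1
      ext i
      simp [eval_monomial]
    rw [h, map_smul, map_pow, ← hA.spectral_theorem, aeval_monomial, ← Algebra.smul_def]
    rfl

theorem trace_aeval_eq_sum (hA : A.IsHermitian) (p : ℝ[X]) :
    (aeval A p).trace = ((∑ i, p.eval (hA.eigenvalues i) : ℝ) : ℂ) := by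
  rw [aeval_eq_conj_diagonal hA, Unitary.conjStarAlgAut_apply, Matrix.trace_mul_cycle,
    Unitary.coe_star_mul_self, Matrix.one_mul, Matrix.trace_diagonal, Complex.ofReal_sum]

theorem aeval_eq_zero_iff (hA : A.IsHermitian) (p : ℝ[X]) :
    aeval A p = 0 ↔ ∀ i, p.eval (hA.eigenvalues i) = 0 := by
  rw [aeval_eq_conj_diagonal hA, map_eq_zero_iff _ (EquivLike.injective _),
    Matrix.diagonal_eq_zero]
  simp [funext_iff]

theorem hasEigenvalue_iff_exists_eigenvalues (hA : A.IsHermitian) (z : ℂ) :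
    Module.End.HasEigenvalue (Matrix.toLin' A) z ↔ ∃ i, z = (hA.eigenvalues i : ℂ) := by
  rw [Module.End.hasEigenvalue_iff_mem_spectrum, Matrix.spectrum_toLin',
    hA.spectrum_eq_image_range]
  simp [eq_comm]

theorem aeval_mulVec_of_mulVec_eq {v : n → ℂ} {c : ℝ} (h : A *ᵥ v = (c : ℂ) • v) (p : ℝ[X]) :
    aeval A p *ᵥ v = ((p.eval c : ℝ) : ℂ) • v := by
  have hpow : ∀ k : ℕ, A ^ k *ᵥ v = (c : ℂ) ^ k • v := by
    intro k
    induction k with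
    | zero => simp
    | succ k ih =>
      rw [pow_succ, ← Matrix.mulVec_mulVec, h, Matrix.mulVec_smul, ih, smul_smul, pow_succ']
  induction p using Polynomial.induction_on' with
  | add p q hp hq => rw [map_add, Matrix.add_mulVec, hp, hq, ← add_smul]; simp
  | monomial k a =>
    rw [aeval_monomial, ← Algebra.smul_def, Matrix.smul_mulVec, hpow, eval_monomial]
    ext i
    simp [mul_assoc]

end Spectral

/-! ### Eigenvalues of the discriminant and of the distance-`d` matrix -/

section Spectrum

variable {V : Type*} [Fintype V] [DecidableEq V] {G : SimpleGraph V} [DecidableRel G.Adj]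

/-- The discriminant of a distance-regular graph of diameter `d` has `d + 1` distinct
eigenvalues. -/
theorem IsDistanceRegular.card_image_eigenvalues (hG : IsDistanceRegular G) :
    (Finset.univ.image (discriminant_isHermitian G).eigenvalues).card = G.diam + 1 := by
  set hP := discriminant_isHermitian G
  set S := Finset.univ.image hP.eigenvalues with hS
  have := hG.1.nonempty
  apply le_antisymm
  -- `P^(d+1)` is itself a polynomial of degree at most `d` in `P`, so a monic polynomial of degree
  -- `d + 1` annihilates `P`.
  · obtain ⟨f, hf⟩ := hG.exists_discriminant_pow (G.diam + 1)
    obtain ⟨p, hp, hpP⟩ := hG.exists_polynomial (G.diam + 1) hf fun x y h =>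
      absurd (hG.dist_le_diam x y) (by omega)
    have hdeg : (X ^ (G.diam + 1) - p).natDegree = G.diam + 1 := by
      rw [natDegree_sub_eq_left_of_natDegree_lt, natDegree_X_pow]
      rw [natDegree_X_pow]
      by_cases h0 : p = 0
      · simp [h0]
      · exact (natDegree_lt_iff_degree_lt h0).2 hp
    have hne : (X ^ (G.diam + 1) - p) ≠ 0 := fun h => by
      rw [h, natDegree_zero] at hdeg
      omega
    have hroot := (aeval_eq_zero_iff hP (X ^ (G.diam + 1) - p)).1 (by
      rw [map_sub, hpP, map_pow, aeval_X, sub_self])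
    have hsub : S ⊆ (X ^ (G.diam + 1) - p).roots.toFinset := by
      intro θ hθ
      obtain ⟨i, -, rfl⟩ := Finset.mem_image.1 hθ
      rw [Multiset.mem_toFinset, mem_roots hne]
      exact hroot i
    calc S.card ≤ _ := Finset.card_le_card hsub
      _ ≤ _ := Multiset.toFinset_card_le _
      _ ≤ _ := card_roots' _
      _ = _ := hdeg
  -- With at most `d` eigenvalues, the product of the `X - θ` annihilates `P`. At a pair of vertices
  -- whose distance is its degree, only the leading power contributes, and it is nonzero.
  · by_contra hlt
    obtain ⟨x, z, hxz⟩ := G.exists_dist_eq_diam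
    obtain ⟨y, hy, -⟩ := exists_dist_eq_of_le hG.1 (u := x) (v := z) (i := S.card) (by omega)
    have hpos : 0 < S.card := by
      rw [Finset.card_pos, hS]
      exact Finset.univ_nonempty.image _
    set q : ℝ[X] := ∏ θ ∈ S, (X - C θ) with hq
    have hqm : q.Monic := monic_prod_of_monic _ _ fun θ _ => monic_X_sub_C θ
    have hqd : q.natDegree = S.card := by
      rw [hq, natDegree_prod_of_monic _ _ fun θ _ => monic_X_sub_C θ]
      simp
    have hq0 : aeval (discriminant G) q = 0 := by
      rw [aeval_eq_zero_iff hP]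
      intro i
      rw [hq, eval_prod]
      exact Finset.prod_eq_zero (Finset.mem_image_of_mem _ (Finset.mem_univ i)) (by simp)
    have hr : (q - X ^ S.card).natDegree < S.card := by
      rcases eq_or_ne (q - X ^ S.card) 0 with h0 | h0
      · rw [h0, natDegree_zero]
        exact hpos
      · rw [natDegree_lt_iff_degree_lt h0]
        have hdq : q.degree = S.card := by rw [degree_eq_natDegree hqm.ne_zero, hqd]
        rw [← hdq]
        exact degree_sub_lt_left (by rw [hdq, degree_X_pow]) hqm.ne_zero
          (by rw [hqm.leadingCoeff, (monic_X_pow _).leadingCoeff])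
    have h1 := hG.aeval_discriminant_apply_eq_zero (x := x) (y := y) (hr.trans_eq hy.symm)
    rw [map_sub, hq0, map_pow, aeval_X, zero_sub, Matrix.neg_apply, neg_eq_zero, ← hy] at h1
    exact hG.discriminant_pow_dist_apply_ne_zero x y h1

theorem IsDistanceRegular.exists_spectrum (hG : IsDistanceRegular G) :
    ∃ μ : Fin (G.diam + 1) → ℝ, IsOrderedDiscriminantSpectrum G μ := by
  refine ⟨fun j => Finset.orderEmbOfFin _ hG.card_image_eigenvalues j.rev, fun i j hij => ?_,
    fun z => ?_⟩
  · exact (Finset.orderEmbOfFin _ hG.card_image_eigenvalues).strictMono (Fin.rev_lt_rev.2 hij)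
  · rw [hasEigenvalue_iff_exists_eigenvalues (discriminant_isHermitian G)]
    constructor
    · rintro ⟨i, rfl⟩
      have hi : (discriminant_isHermitian G).eigenvalues i ∈
          Set.range (Finset.orderEmbOfFin _ hG.card_image_eigenvalues) := by
        rw [Finset.range_orderEmbOfFin]
        simp
      obtain ⟨j, hj⟩ := hi
      exact ⟨j.rev, by simp only [Fin.rev_rev, hj]⟩
    · rintro ⟨j, rfl⟩
      obtain ⟨i, -, hi⟩ := Finset.mem_image.1
        (Finset.orderEmbOfFin_mem _ hG.card_image_eigenvalues j.rev)
      exact ⟨i, by rw [hi]⟩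

variable {d : ℕ} {μ : Fin (d + 1) → ℝ}

theorem IsOrderedDiscriminantSpectrum.exists_eigenvalues_eq
    (hμ : IsOrderedDiscriminantSpectrum G μ) (j : Fin (d + 1)) :
    ∃ i, (discriminant_isHermitian G).eigenvalues i = μ j := by
  obtain ⟨i, hi⟩ := (hasEigenvalue_iff_exists_eigenvalues (discriminant_isHermitian G) (μ j)).1
    ((hμ.2 _).2 ⟨j, rfl⟩)
  exact ⟨i, by exact_mod_cast hi.symm⟩

theorem IsOrderedDiscriminantSpectrum.exists_eq_eigenvalues
    (hμ : IsOrderedDiscriminantSpectrum G μ) (i : V) :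
    ∃ j, (discriminant_isHermitian G).eigenvalues i = μ j := by
  obtain ⟨j, hj⟩ := (hμ.2 _).1
    ((hasEigenvalue_iff_exists_eigenvalues (discriminant_isHermitian G) _).2 ⟨i, rfl⟩)
  exact ⟨j, by exact_mod_cast hj⟩

theorem IsOrderedDiscriminantSpectrum.aeval_eq_zero_iff
    (hμ : IsOrderedDiscriminantSpectrum G μ) (p : ℝ[X]) :
    aeval (discriminant G) p = 0 ↔ ∀ j, p.eval (μ j) = 0 := by
  rw [GroverWalk.aeval_eq_zero_iff (discriminant_isHermitian G)]
  constructor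
  · intro h j
    obtain ⟨i, hi⟩ := hμ.exists_eigenvalues_eq j
    rw [← hi, h]
  · intro h i
    obtain ⟨j, hj⟩ := hμ.exists_eq_eigenvalues i
    rw [hj, h]

theorem IsDistanceRegular.sum_norm_discriminant [Nontrivial V] (hG : IsDistanceRegular G) (u : V) :
    ∑ v, ‖discriminant G u v‖ = 1 := by
  obtain ⟨k, hk, hP⟩ := hG.exists_discriminant_eq
  have hk0 : (k : ℝ) ≠ 0 := by
    rw [← hk u]
    exact_mod_cast (hG.degree_pos u).ne'
  simp_rw [hP, Matrix.smul_apply, norm_smul, ← Finset.mul_sum, SimpleGraph.adjMatrix_apply,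
    apply_ite norm, norm_one, norm_zero, Finset.sum_boole]
  have hc : (Finset.univ.filter fun v => G.Adj u v).card = k := by
    rw [← hk u, ← G.card_neighborFinset_eq_degree, SimpleGraph.neighborFinset_eq_filter]
  rw [hc]
  simp [hk0]

theorem IsDistanceRegular.discriminant_mulVec_one [Nontrivial V] (hG : IsDistanceRegular G) :
    discriminant G *ᵥ 1 = ((1 : ℝ) : ℂ) • (1 : V → ℂ) := by
  obtain ⟨k, hk, hP⟩ := hG.exists_discriminant_eq
  ext u
  have hk0 : (k : ℂ) ≠ 0 := by
    rw [← hk u]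
    exact_mod_cast (hG.degree_pos u).ne'
  rw [hP, Matrix.smul_mulVec]
  simp [SimpleGraph.adjMatrix_mulVec_apply, hk, hk0]

/-- Gershgorin's theorem bounds every eigenvalue by the absolute row sum `1`, and the constant
vector attains it. -/
theorem IsOrderedDiscriminantSpectrum.zero_eq_one [Nontrivial V]
    (hμ : IsOrderedDiscriminantSpectrum G μ) (hG : IsDistanceRegular G) : μ 0 = 1 := by
  apply le_antisymm
  · obtain ⟨u, hu⟩ := eigenvalue_mem_ball ((hμ.2 _).2 ⟨0, rfl⟩)
    have h0 : discriminant G u u = 0 := by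
      obtain ⟨k, -, hP⟩ := hG.exists_discriminant_eq
      simp [hP]
    rw [h0, mem_closedBall_zero_iff, Complex.norm_real] at hu
    refine (le_abs_self _).trans (hu.trans ?_)
    rw [← hG.sum_norm_discriminant u]
    exact Finset.sum_le_sum_of_subset_of_nonneg (Finset.erase_subset _ _)
      fun _ _ _ => norm_nonneg _
  · have h1 : Module.End.HasEigenvalue (Matrix.toLin' (discriminant G)) ((1 : ℝ) : ℂ) := by
      refine Module.End.hasEigenvalue_of_hasEigenvector (x := 1)
        ⟨Module.End.mem_eigenspace_iff.2 ?_, one_ne_zero⟩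
      rw [Matrix.toLin'_apply, hG.discriminant_mulVec_one]
    obtain ⟨j, hj⟩ := (hμ.2 _).1 h1
    have hj' : (1 : ℝ) = μ j := by exact_mod_cast hj
    rw [hj']
    exact hμ.1.antitone (Fin.zero_le j)

variable (G) in
/-- The matrix of the distance-`d` graph, where `d` is the diameter. -/
noncomputable def antipodalMatrix : Matrix V V ℂ :=
  Matrix.of fun x y => if G.dist x y = G.diam then 1 else 0

/-- The two factors have disjoint supports: `q(P)` vanishes at distance `d`. -/
theorem trace_aeval_mul_eq_zero (hG : IsDistanceRegular G) {p q : ℝ[X]}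
    (hp : aeval (discriminant G) p = antipodalMatrix G) (hq : q.natDegree < G.diam) :
    (aeval (discriminant G) (p * q)).trace = 0 := by
  rw [map_mul, hp, Matrix.trace]
  refine Finset.sum_eq_zero fun x _ => ?_
  rw [Matrix.diag_apply, Matrix.mul_apply]
  refine Finset.sum_eq_zero fun y _ => ?_
  by_cases h : G.dist x y = G.diam
  · rw [hG.aeval_discriminant_apply_eq_zero, mul_zero]
    rwa [G.dist_comm, h]
  · simp [antipodalMatrix, h]

/-- No other `μ l` lies between two consecutive ones, so corresponding factors have equal sign. -/
theorem prod_sub_mul_prod_sub_pos {m : ℕ} {μ : Fin (m + 1) → ℝ} (hμ : StrictAnti μ)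
    {i j : Fin (m + 1)} (hij : (j : ℕ) = i + 1) :
    0 < (∏ l ∈ (Finset.univ.erase i).erase j, (μ i - μ l)) *
      ∏ l ∈ (Finset.univ.erase i).erase j, (μ j - μ l) := by
  rw [← Finset.prod_mul_distrib]
  refine Finset.prod_pos fun l hl => ?_
  obtain ⟨hlj, hli, -⟩ := by simpa only [Finset.mem_erase] using hl
  rcases lt_or_gt_of_ne hli with h | h
  · have hj : l < j := by
      rw [Fin.lt_def] at h ⊢
      omega
    exact mul_pos_of_neg_of_neg (sub_neg.2 (hμ h)) (sub_neg.2 (hμ hj))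
  · have hj : j < l := by
      have : (l : ℕ) ≠ j := fun h => hlj (Fin.ext h)
      rw [Fin.lt_def]
      have : (i : ℕ) < l := h
      omega
    exact mul_pos (sub_pos.2 (hμ h)) (sub_pos.2 (hμ hj))

/-- If the distance-`d` matrix is an involution and a polynomial in the discriminant, this
polynomial takes alternating values `±1` on the spectrum. -/
theorem eval_eq_neg_one_pow_of_aeval_eq [Nontrivial V] (hG : IsDistanceRegular G)
    (hd : G.diam = d) (hμ : IsOrderedDiscriminantSpectrum G μ)
    (hinv : antipodalMatrix G * antipodalMatrix G = 1) (hone : antipodalMatrix G *ᵥ 1 = 1)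
    {p : ℝ[X]} (hp : aeval (discriminant G) p = antipodalMatrix G) (j : Fin (d + 1)) :
    p.eval (μ j) = (-1 : ℝ) ^ (j : ℕ) := by
  have hsq : ∀ j, p.eval (μ j) * p.eval (μ j) = 1 := by
    have h0 : aeval (discriminant G) (p * p - 1) = 0 := by
      rw [map_sub, map_mul, hp, hinv, map_one, sub_self]
    intro j
    have := (hμ.aeval_eq_zero_iff _).1 h0 j
    simpa [sub_eq_zero] using this
  have h1 : p.eval (μ 0) = 1 := by
    have h := aeval_mulVec_of_mulVec_eq hG.discriminant_mulVec_one p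
    rw [hp, hone] at h
    obtain ⟨u⟩ := hG.1.nonempty
    have hu := congrFun h u
    simp only [Pi.one_apply, Pi.smul_apply, smul_eq_mul, mul_one] at hu
    rw [hμ.zero_eq_one hG]
    exact_mod_cast hu.symm
  have hstep : ∀ i j : Fin (d + 1), (j : ℕ) = i + 1 → p.eval (μ j) = -p.eval (μ i) := by
    intro i j hij
    have hne : j ≠ i := fun h => by rw [h] at hij; omega
    rcases mul_self_eq_mul_self_iff.1 ((hsq j).trans (hsq i).symm) with heq | heq
    swap
    · exact heq
    exfalso
    -- On the spectrum, `q` lives only at `μ i` and `μ j`, with one sign there, and has degree `d -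
    -- 1`. If `p` did not change sign, `p q` would have constant sign and nonzero trace.
    set q : ℝ[X] := ∏ l ∈ (Finset.univ.erase i).erase j, (X - C (μ l)) with hq
    have hqd : q.natDegree < G.diam := by
      rw [hq, natDegree_prod_of_monic _ _ fun l _ => monic_X_sub_C (μ l)]
      simp only [natDegree_X_sub_C, Finset.sum_const, smul_eq_mul, mul_one]
      rw [Finset.card_erase_of_mem (by simp [hne]), Finset.card_erase_of_mem (Finset.mem_univ _),
        Finset.card_univ, Fintype.card_fin, hd]
      have := j.2
      omega
    have hqe : ∀ t, q.eval t = ∏ l ∈ (Finset.univ.erase i).erase j, (t - μ l) := fun t => by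
      simp [hq, eval_prod]
    have hpos : 0 < q.eval (μ i) * q.eval (μ j) := by
      rw [hqe, hqe]
      exact prod_sub_mul_prod_sub_pos hμ.1 hij
    have htr := trace_aeval_mul_eq_zero hG hp hqd
    rw [trace_aeval_eq_sum (discriminant_isHermitian G), Complex.ofReal_eq_zero] at htr
    -- Multiplying by `c` normalises the unknown sign of `p q` to be positive.
    set c := p.eval (μ i) * q.eval (μ i) with hc
    have hci : 0 < c * (p * q).eval (μ i) := by
      have hqi : q.eval (μ i) ≠ 0 := left_ne_zero_of_mul hpos.ne'
      rw [eval_mul, hc]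
      have : p.eval (μ i) * q.eval (μ i) * (p.eval (μ i) * q.eval (μ i)) =
        (p.eval (μ i) * p.eval (μ i)) * (q.eval (μ i) * q.eval (μ i)) := by ring
      rw [this, hsq, one_mul]
      exact mul_self_pos.2 hqi
    have hcj : 0 < c * (p * q).eval (μ j) := by
      rw [eval_mul, hc, heq]
      have : p.eval (μ i) * q.eval (μ i) * (p.eval (μ i) * q.eval (μ j)) =
        (p.eval (μ i) * p.eval (μ i)) * (q.eval (μ i) * q.eval (μ j)) := by ring
      rw [this, hsq, one_mul]
      exact hpos
    have hnn : ∀ l, 0 ≤ c * (p * q).eval (μ l) := by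
      intro l
      by_cases hli : l = i
      · rw [hli]; exact hci.le
      by_cases hlj : l = j
      · rw [hlj]; exact hcj.le
      have : q.eval (μ l) = 0 := by
        rw [hqe]
        exact Finset.prod_eq_zero (i := l) (by simp [hli, hlj]) (sub_self _)
      simp [this]
    obtain ⟨v, hv⟩ := hμ.exists_eigenvalues_eq i
    have hsum : 0 < ∑ w, c * (p * q).eval ((discriminant_isHermitian G).eigenvalues w) := by
      refine Finset.sum_pos' (fun w _ => ?_) ⟨v, Finset.mem_univ v, ?_⟩
      · obtain ⟨l, hl⟩ := hμ.exists_eq_eigenvalues w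
        rw [hl]
        exact hnn l
      · rw [hv]
        exact hci
    rw [← Finset.mul_sum, htr, mul_zero] at hsum
    exact lt_irrefl _ hsum
  have hall : ∀ (m : ℕ) (hm : m < d + 1), p.eval (μ ⟨m, hm⟩) = (-1 : ℝ) ^ m := by
    intro m
    induction m with
    | zero => intro hm; simpa using h1
    | succ m ih =>
      intro hm
      rw [hstep ⟨m, by omega⟩ ⟨m + 1, hm⟩ rfl, ih, pow_succ]
      ring
  exact hall j j.2

end Spectrum

/-! ### Unique antipodes and perfect state transfer -/

section Transfer

variable {V : Type*} {G : SimpleGraph V}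

variable (G) in
/-- Every vertex has exactly one vertex at distance the diameter, and the diameter is positive. -/
def HasUniqueAntipodes : Prop :=
  0 < G.diam ∧ ∀ u, ∃ v, G.dist u v = G.diam ∧ ∀ w, G.dist u w = G.diam → w = v

/-- Fibres of size two already make antipodality vacuous, and they exclude `d = 0`, where each fibre
is a single vertex. -/
theorem hasUniqueAntipodes_iff (hG : IsDistanceRegular G) :
    HasUniqueAntipodes G ↔ IsAntipodal G ∧ ∀ u : V, (fibre G u).ncard = 2 := by
  have hne : 0 < G.diam → ∀ {u v : V}, G.dist u v = G.diam → v ≠ u := by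
    rintro h u v huv rfl
    simp at huv
    omega
  constructor
  · rintro ⟨hd, h⟩
    refine ⟨fun u v w hv hw hvw => ?_, fun u => ?_⟩
    · obtain ⟨x, -, hx⟩ := h u
      exact absurd ((hx v hv).trans (hx w hw).symm) hvw
    · obtain ⟨x, hx, hx'⟩ := h u
      refine Set.ncard_eq_two.2 ⟨u, x, (hne hd hx).symm, ?_⟩
      ext w
      simp only [fibre, Set.mem_ofPred_eq, Set.mem_insert_iff, Set.mem_singleton_iff]
      exact or_congr_right ⟨hx' w, fun h => h ▸ hx⟩
  · rintro ⟨-, h⟩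
    have hd : 0 < G.diam := by
      rw [Nat.pos_iff_ne_zero]
      intro h0
      obtain ⟨u⟩ := hG.1.nonempty
      have hu : fibre G u = {u} := by
        ext w
        simp [fibre, h0, hG.1.dist_eq_zero_iff, eq_comm]
      have := h u
      rw [hu, Set.ncard_singleton] at this
      omega
    refine ⟨hd, fun u => ?_⟩
    have hu : u ∈ fibre G u := Or.inl rfl
    have hcard : (fibre G u \ {u}).ncard = 1 := by
      rw [Set.ncard_sdiff_singleton_of_mem hu, h u]
    obtain ⟨v, hv⟩ := Set.ncard_eq_one.1 hcard
    have hmem : ∀ w, G.dist u w = G.diam ↔ w = v := fun w => by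
      rw [← Set.mem_singleton_iff (a := w), ← hv]
      simp only [fibre, Set.mem_sdiff, Set.mem_ofPred_eq, Set.mem_singleton_iff]
      exact ⟨fun h => ⟨Or.inr h, hne hd h⟩, fun h => h.1.resolve_left h.2⟩
    exact ⟨v, (hmem v).2 rfl, fun w => (hmem w).1⟩

variable [Fintype V]

theorem antipodalMatrix_mulVec_one (h : HasUniqueAntipodes G) :
    antipodalMatrix G *ᵥ 1 = (1 : V → ℂ) := by
  ext u
  obtain ⟨v, hv, hv'⟩ := h.2 u
  simp only [antipodalMatrix, Matrix.mulVec, dotProduct, Matrix.of_apply, Pi.one_apply, mul_one]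
  rw [Finset.sum_eq_single v (fun w _ hw => if_neg fun h => hw (hv' w h)) (by simp), if_pos hv]

variable [DecidableEq V]

theorem antipodalMatrix_mulVec_single (h : HasUniqueAntipodes G) {u v : V}
    (huv : G.dist u v = G.diam) :
    antipodalMatrix G *ᵥ Pi.single u 1 = (Pi.single v 1 : V → ℂ) := by
  ext w
  rw [Matrix.mulVec_single_one]
  obtain ⟨x, -, hx⟩ := h.2 u
  obtain rfl := hx v huv
  simp only [Matrix.col_apply, antipodalMatrix, Matrix.of_apply, Pi.single_apply]
  exact if_congr ⟨fun hw => hx w (by rw [G.dist_comm, hw]), fun hw => by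
    rw [hw, G.dist_comm, huv]⟩ rfl rfl

theorem antipodalMatrix_mul_self (h : HasUniqueAntipodes G) :
    antipodalMatrix G * antipodalMatrix G = 1 := by
  refine Matrix.ext_of_mulVec_single fun u => ?_
  obtain ⟨v, hv, -⟩ := h.2 u
  rw [← Matrix.mulVec_mulVec, antipodalMatrix_mulVec_single h hv,
    antipodalMatrix_mulVec_single h (by rw [G.dist_comm, hv]), Matrix.one_mulVec]

variable [DecidableRel G.Adj]

/-- State transfer at time `τ` forces unique antipodes, and the Chebyshev polynomial of the
discriminant is the distance-`d` matrix. -/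
theorem IsDistanceRegular.aeval_chebyshev_eq_of_pst (hG : IsDistanceRegular G) {u v : V} {τ : ℕ}
    (h : PSTFromTo G u v τ) :
    HasUniqueAntipodes G ∧
      aeval (discriminant G) (Chebyshev.T ℝ (τ : ℤ)) = antipodalMatrix G := by
  obtain ⟨huv, γ, hγ, hU⟩ := h
  have : Nontrivial V := ⟨u, v, huv⟩
  rw [evolution_pow_mulVec_vertexState_iff (boundary_mul_conjTranspose G hG.degree_pos) τ u v hγ]
    at hU
  obtain ⟨f, hf⟩ := hG.exists_aeval_discriminant (Chebyshev.T ℝ (τ : ℤ))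
  have hone := aeval_mulVec_of_mulVec_eq hG.discriminant_mulVec_one (Chebyshev.T ℝ (τ : ℤ))
  set M := aeval (discriminant G) (Chebyshev.T ℝ (τ : ℤ))
  have hγ0 : γ ≠ 0 := by
    rintro rfl
    simp at hγ
  have hcol : ∀ w, (f (G.dist u w) : ℂ) = if w = v then γ else 0 := fun w => by
    have := congrFun hU w
    rw [Matrix.mulVec_single_one, Matrix.col_apply, hf w u, G.dist_comm] at this
    rw [this]
    simp [Pi.single_apply]
  set j := G.dist u v with hj
  have hj0 : 0 < j := hG.1.pos_dist_of_ne huv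
  have hfj : (f j : ℂ) = γ := by
    rw [hj, hcol, if_pos rfl]
  -- Every vertex at distance `j` from `u` carries the same nonzero entry `γ`, while the column has
  -- only one nonzero entry.
  have hsphere : {w : V | G.dist u w = j} = {v} := by
    ext w
    simp only [Set.mem_ofPred_eq, Set.mem_singleton_iff]
    refine ⟨fun hw => ?_, fun hw => by rw [hw]⟩
    by_contra hne
    have := hcol w
    rw [hw, hfj, if_neg hne] at this
    exact hγ0 this
  have hone' : ∀ x, ∃ y, {w : V | G.dist x w = j} = {y} := fun x => by
    rw [← Set.ncard_eq_one, hG.ncard_sphere_eq j x u, hsphere, Set.ncard_singleton]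
  have hex : ∀ x, ∃ y, G.dist x y = j ∧ ∀ w, G.dist x w = j → w = y := fun x => by
    obtain ⟨y, hy⟩ := hone' x
    have hm : ∀ w, G.dist x w = j ↔ w = y := fun w => by
      rw [← Set.mem_singleton_iff (a := w), ← hy, Set.mem_ofPred_eq]
    exact ⟨y, (hm y).2 rfl, fun w => (hm w).1⟩
  have hjd : j = G.diam := by
    refine hG.eq_diam_of_unique hj0 (fun x => (hex x).imp fun y hy => hy.1) ?_
    intro x y z hy hz
    obtain ⟨t, -, ht⟩ := hex x
    rw [ht y hy, ht z hz]
  have hanti : HasUniqueAntipodes G := ⟨hjd ▸ hj0, hjd ▸ hex⟩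
  refine ⟨hanti, ?_⟩
  have hM : M = γ • antipodalMatrix G := by
    ext x y
    rw [hf x y, Matrix.smul_apply, antipodalMatrix, Matrix.of_apply, ← hjd]
    split_ifs with hxy
    · rw [hxy, hfj, smul_eq_mul, mul_one]
    -- Spheres of equal radius have equal size, so every occurring distance occurs from `u`, and
    -- column `u` determines all entries.
    · have hne : {w : V | G.dist u w = G.dist x y}.Nonempty := by
        rw [← Set.ncard_pos, hG.ncard_sphere_eq _ u x, Set.ncard_pos]
        exact ⟨y, rfl⟩
      obtain ⟨w, hw⟩ := hne
      have hwv : w ≠ v := fun h => hxy (by rw [← hw, h])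
      have := hcol w
      rw [hw, if_neg hwv] at this
      rw [this, smul_zero]
  -- Apply both sides to the constant vector: `T_τ(1) = 1`, while `A_d` fixes that vector.
  have hγ1 : γ = 1 := by
    rw [hM, Matrix.smul_mulVec, antipodalMatrix_mulVec_one hanti, Chebyshev.T_eval_one] at hone
    simpa using congrFun hone u
  rw [hM, hγ1, one_smul]

theorem IsDistanceRegular.pst_iff_of_aeval_eq (hG : IsDistanceRegular G)
    (hanti : HasUniqueAntipodes G) {τ : ℕ}
    (hT : aeval (discriminant G) (Chebyshev.T ℝ (τ : ℤ)) = antipodalMatrix G) (u v : V) :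
    PSTFromTo G u v τ ↔ G.dist u v = G.diam := by
  obtain ⟨x, hx, hx'⟩ := hanti.2 u
  have hux : u ≠ x := by
    rintro rfl
    have := hanti.1
    simp at hx
    omega
  have : Nontrivial V := ⟨u, x, hux⟩
  have hN := boundary_mul_conjTranspose G hG.degree_pos
  constructor
  · rintro ⟨-, γ, hγ, hU⟩
    rw [evolution_pow_mulVec_vertexState_iff hN τ u v hγ, hT,
      antipodalMatrix_mulVec_single hanti hx] at hU
    have hxv : x = v := by
      by_contra hne
      have := congrFun hU x
      simp [hne] at this
    rw [← hxv, hx]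
  · intro h
    obtain rfl := hx' v h
    refine ⟨hux, 1, norm_one, ?_⟩
    rw [evolution_pow_mulVec_vertexState_iff hN τ u v norm_one, hT,
      antipodalMatrix_mulVec_single hanti hx, one_smul]

theorem IsDistanceRegular.aeval_chebyshev_eq (hG : IsDistanceRegular G)
    (hanti : HasUniqueAntipodes G) {d : ℕ} (hd : G.diam = d) {μ : Fin (d + 1) → ℝ}
    (hμ : IsOrderedDiscriminantSpectrum G μ) {τ : ℕ}
    (hτ : ∀ j, (Chebyshev.T ℝ (τ : ℤ)).eval (μ j) = (-1 : ℝ) ^ (j : ℕ)) :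
    aeval (discriminant G) (Chebyshev.T ℝ (τ : ℤ)) = antipodalMatrix G := by
  have : Nontrivial V := SimpleGraph.nontrivial_of_diam_ne_zero hanti.1.ne'
  have hent : HasDistanceEntries G (antipodalMatrix G) fun i => if i = G.diam then 1 else 0 :=
    fun x y => by
      rw [antipodalMatrix, Matrix.of_apply]
      split_ifs with h <;> simp [h]
  obtain ⟨p, -, hp⟩ := hG.exists_polynomial (G.diam + 1) hent fun x y h =>
    absurd (hG.dist_le_diam x y) (by omega)
  have hpe := eval_eq_neg_one_pow_of_aeval_eq hG hd hμ (antipodalMatrix_mul_self hanti)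
    (antipodalMatrix_mulVec_one hanti) hp
  rw [← hp, ← sub_eq_zero, ← map_sub, hμ.aeval_eq_zero_iff]
  intro j
  rw [eval_sub, hτ, hpe, sub_self]

end Transfer

end GroverWalk

theorem theorem4p2 {V : Type*} [Fintype V] [DecidableEq V] (G : SimpleGraph V)
    [DecidableRel G.Adj] (hG : GroverWalk.IsDistanceRegular G) (d : ℕ) (hd : G.diam = d) :
    (∃ μ : Fin (d + 1) → ℝ, GroverWalk.IsOrderedDiscriminantSpectrum G μ) ∧
      ∀ μ : Fin (d + 1) → ℝ, GroverWalk.IsOrderedDiscriminantSpectrum G μ → ∀ τ : ℕ,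
        (GroverWalk.HasPST G τ ↔
          (GroverWalk.IsAntipodal G ∧ ∀ u : V, (GroverWalk.fibre G u).ncard = 2) ∧
            ∀ j : Fin (d + 1),
              (Polynomial.Chebyshev.T ℝ (τ : ℤ)).eval (μ j) = (-1 : ℝ) ^ (j : ℕ)) ∧
        ((GroverWalk.IsAntipodal G ∧ ∀ u : V, (GroverWalk.fibre G u).ncard = 2) →
          (∀ j : Fin (d + 1),
              (Polynomial.Chebyshev.T ℝ (τ : ℤ)).eval (μ j) = (-1 : ℝ) ^ (j : ℕ)) →
          ∀ u v : V, GroverWalk.PSTFromTo G u v τ ↔ G.dist u v = d) := by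
  refine ⟨hd ▸ hG.exists_spectrum, fun μ hμ τ => ?_⟩
  rw [← GroverWalk.hasUniqueAntipodes_iff hG]
  have hmain : ∀ _ : GroverWalk.HasUniqueAntipodes G, (∀ j : Fin (d + 1),
      (Polynomial.Chebyshev.T ℝ (τ : ℤ)).eval (μ j) = (-1 : ℝ) ^ (j : ℕ)) →
      ∀ u v : V, GroverWalk.PSTFromTo G u v τ ↔ G.dist u v = d := fun hanti hτ u v =>
    hd ▸ hG.pst_iff_of_aeval_eq hanti (hG.aeval_chebyshev_eq hanti hd hμ hτ) u v
  refine ⟨⟨?_, ?_⟩, hmain⟩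
  · rintro ⟨u, v, huv⟩
    have : Nontrivial V := ⟨u, v, huv.1⟩
    obtain ⟨hanti, hT⟩ := hG.aeval_chebyshev_eq_of_pst huv
    exact ⟨hanti, GroverWalk.eval_eq_neg_one_pow_of_aeval_eq hG hd hμ
      (GroverWalk.antipodalMatrix_mul_self hanti) (GroverWalk.antipodalMatrix_mulVec_one hanti) hT⟩
  · rintro ⟨hanti, hτ⟩
    obtain ⟨u⟩ := hG.1.nonempty
    obtain ⟨v, hv, -⟩ := hanti.2 u
    exact ⟨u, v, (hmain hanti hτ u v).2 (hd ▸ hv)⟩
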